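/- Consider a $K$-armed stochastic bandit with independent rewards $X_{i,s}$ ($i\in\{1,\dots,K\}$, $s\ge 1$), where $X_{i,s}$, the reward received at the $s$-th pull of arm $i$, has a law depending only on $i$, with mean $\mu_i$, satisfying $\mathbb{E}\, e^{\lambda (X_{i,s}-\mu_i)}\le e^{\lambda^2/2}$ for all $\lambda\in\mathbb{R}$. Suppose that for known $\mu^*\in\mathbb{R}$ and $\epsilon>0$ one arm has mean $\mu^*$ and every other arm has mean at most $\mu^*-\epsilon$. Put $\Delta_i=\mu^*-\mu_i$. Let $I_t$ be the arm pulled in round $t$ and $T_i(t)$ the number of pulls of arm $i$ in rounds $1,\dots,t$. Consider the policy that plays $I_t=t$ for $t\le K$ and that, in each round $t\ge K+1$, draws $I_t$, conditionally on the arms pulled and rewards received so far, from the probability vector $$p_t(i)=c\,\frac{\exp\left(-\frac13\sum_{s=1}^{T_i(t-1)}(X_{i,s}-\mu^*)^2\right)}{\int_{-\infty}^{\mu^*-\epsilon}\exp\left(-\frac13\sum_{s=1}^{T_i(t-1)}(X_{i,s}-v)^2\right)dv},$$ where $c>0$ is such that $\sum_{i=1}^K p_t(i)=1$. Then, for every $n$,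 the regret $R_n=\mathbb{E}\sum_{t=1}^n(\mu^*-\mu_{I_t})$ satisfies $$R_n\le\sum_{i:\Delta_i>0}\left(\Delta_i+\frac{80+8\log(\Delta_i/\epsilon)}{\Delta_i}\right).$$ -/

import Mathlib

open MeasureTheory ProbabilityTheory

noncomputable section

namespace Bandit

variable {K : ℕ}

/-- The mean of the reward distribution of arm `i`. -/
def mean (ν : Fin K → Measure ℝ) (i : Fin K) : ℝ := ∫ x, x ∂(ν i)

/-- The gap of arm `i`: the largest mean minus the mean of arm `i`. -/
def gap (ν : Fin K → Measure ℝ) (i : Fin K) : ℝ := (⨆ j, mean ν j) - mean ν i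

/-- The BPR setting: every reward distribution is a probability measure that is 1-sub-Gaussian
around its mean, one arm has mean `muStar`, and every other arm has mean at most
`muStar - ε`, where `ε > 0`. -/
structure IsBPR (ν : Fin K → Measure ℝ) (muStar ε : ℝ) : Prop where
  prob : ∀ i, IsProbabilityMeasure (ν i)
  subGaussian : ∀ i, HasSubgaussianMGF (fun x => x - mean ν i) 1 (ν i)
  eps_pos : 0 < ε
  best : ∃ i, mean ν i = muStar ∧ ∀ j, j ≠ i → mean ν j ≤ muStar - ε

/-- A table of independent rewards in which the rewards of arm `i` all have law `ν i`.
`X i s` is the reward received at the `(s + 1)`-st pull of arm `i`. -/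
structure IsRewardTable {Ω : Type*} [MeasurableSpace Ω] (P : Measure Ω)
    (ν : Fin K → Measure ℝ) (X : Fin K → ℕ → Ω → ℝ) : Prop where
  measurable : ∀ i s, Measurable (X i s)
  law : ∀ i s, P.map (X i s) = ν i
  indep : iIndepFun (fun p : Fin K × ℕ => X p.1 p.2) P

/-- The number of pulls of arm `i` in the first `t` rounds (rounds are numbered from `0`). -/
def pulls (a : ℕ → Fin K) (t : ℕ) (i : Fin K) : ℕ :=
  ((Finset.range t).filter (fun s => a s = i)).card

/-- The reward received in round `t`. -/
def reward {Ω : Type*} (X : Fin K → ℕ → Ω → ℝ) (I : ℕ → Ω → Fin K) (t : ℕ) (ω : Ω) : ℝ :=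
  X (I t ω) (pulls (fun s => I s ω) t (I t ω)) ω

/-- The history before round `t`: the arms pulled and the rewards received so far. -/
def history {Ω : Type*} (X : Fin K → ℕ → Ω → ℝ) (I : ℕ → Ω → Fin K) (t : ℕ) (ω : Ω) :
    Fin t → Fin K × ℝ :=
  fun s => (I s ω, reward X I s ω)

/-- The ratio of Gaussian likelihoods computed from the first `T` rewards `x 0, …, x (T - 1)`
of an arm. -/
def weight (muStar ε : ℝ) (x : ℕ → ℝ) (T : ℕ) : ℝ :=
  Real.exp (-(1 / 3) * ∑ s ∈ Finset.range T, (x s - muStar) ^ 2) /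
    ∫ v in Set.Iic (muStar - ε), Real.exp (-(1 / 3) * ∑ s ∈ Finset.range T, (x s - v) ^ 2)

/-- The sampling probabilities of the policy in round `t`: the weights of the arms, normalized
to sum to one. -/
def prob {Ω : Type*} (muStar ε : ℝ) (X : Fin K → ℕ → Ω → ℝ) (I : ℕ → Ω → Fin K)
    (t : ℕ) (i : Fin K) (ω : Ω) : ℝ :=
  weight muStar ε (fun s => X i s ω) (pulls (fun s => I s ω) t i) /
    ∑ j, weight muStar ε (fun s => X j s ω) (pulls (fun s => I s ω) t j)

/-- The arms `I 0, I 1, …` are selected by the policy: each arm is pulled once in the first `K`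
rounds, and afterwards the conditional law of the selected arm given the history is the vector
of sampling probabilities. -/
structure IsPolicyRun {Ω : Type*} [MeasurableSpace Ω] (P : Measure Ω) (muStar ε : ℝ)
    (X : Fin K → ℕ → Ω → ℝ) (I : ℕ → Ω → Fin K) : Prop where
  measurable : ∀ t, Measurable (I t)
  init : ∀ t, t < K → ∀ ω, (I t ω : ℕ) = t
  sample : ∀ t, K ≤ t → ∀ i : Fin K,
    P⟦I t ⁻¹' {i} | MeasurableSpace.comap (history X I t) inferInstance⟧
      =ᵐ[P] prob muStar ε X I t i

/-- The regret after `n` rounds. -/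
def regret {Ω : Type*} [MeasurableSpace Ω] (P : Measure Ω) (ν : Fin K → Measure ℝ)
    (I : ℕ → Ω → Fin K) (n : ℕ) : ℝ :=
  ∫ ω, ∑ t ∈ Finset.range n, ((⨆ j, mean ν j) - mean ν (I t ω)) ∂P

end Bandit

end

/-! Completing the square turns the weight of an arm with `T` rewards into the reciprocal of ∫_{u>ε}
exp(-(2uS + Tu²)/3) du, where `S` is the sum of its rewards centred at μ*. Call this integral W.

For the best arm, `S` is centred and sub-Gaussian, so its integrand has mean at most exp(-Tu²/9).
Summing over T ≥ 1 and then integrating over u > ε bounds the total expectation of W by 9/ε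
(`sum_integral_invWeight_le`).

For an arm of gap D, `S` drifts like -DT. The counts T with S > -(3/4)DT number at most 32/D² in
expectation. At the other counts W grows like exp(TD²/8), so once T exceeds about 8(1 + log(D/ε))/D²
the weight is at most 3ε/D² (`weight_le_of_sum_le`).

All probabilities share one normalizer, so then p_t(i) ≤ (3ε/D²) W_b p_t(b), with b the best arm. In
expectation p_t(b) may be replaced by the indicator that b is pulled, and each count of b occurs in
at most one such pull. These pulls of i thus cost (3ε/D²)(9/ε) = 27/D²
(`sum_integral_good_pulls_le`). -/

noncomputable section

namespace Bandit

/-! ### Reciprocal weights as Gaussian integrals. -/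

/-- The reciprocal weight of an arm, in terms of the centred sum `S` of its first `T` rewards. -/
def invWeight (ε S T : ℝ) : ℝ :=
  ∫ u in Set.Ioi ε, Real.exp (-(1 / 3) * (2 * u * S + T * u ^ 2))

theorem integrable_exp_invWeight (S : ℝ) {T : ℝ} (hT : 0 < T) :
    Integrable fun u : ℝ => Real.exp (-(1 / 3) * (2 * u * S + T * u ^ 2)) := by
  have h2 := integrable_cexp_quadratic' (b := ((-(T / 3) : ℝ) : ℂ)) (by simpa using hT)
    ((-(2 / 3) * S : ℝ) : ℂ) 0
  refine h2.norm.congr (Filter.Eventually.of_forall fun u => ?_)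
  simp only [Complex.norm_exp]
  congr 1
  have : ((-(T / 3) : ℝ) : ℂ) * (u : ℂ) ^ 2 + ((-(2 / 3) * S : ℝ) : ℂ) * (u : ℂ) + 0
      = ((-(1 / 3) * (2 * u * S + T * u ^ 2) : ℝ) : ℂ) := by
    push_cast; ring
  rw [this, Complex.ofReal_re]

theorem invWeight_nonneg (ε S T : ℝ) : 0 ≤ invWeight ε S T :=
  integral_nonneg fun _ => (Real.exp_pos _).le

theorem invWeight_pos (ε S : ℝ) {T : ℝ} (hT : 0 < T) : 0 < invWeight ε S T := by
  unfold invWeight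
  rw [integral_pos_iff_support_of_nonneg (fun _ => (Real.exp_pos _).le)
    (integrable_exp_invWeight S hT).integrableOn]
  have : (Function.support fun u : ℝ => Real.exp (-(1 / 3) * (2 * u * S + T * u ^ 2)))
      = Set.univ := by
    ext u; simp [Real.exp_ne_zero]
  rw [this]; simp

theorem measurable_invWeight (ε : ℝ) : Measurable fun q : ℝ × ℝ => invWeight ε q.1 q.2 := by
  unfold invWeight
  refine (StronglyMeasurable.integral_prod_right' (ν := volume.restrict (Set.Ioi ε))
    (f := fun z : (ℝ × ℝ) × ℝ =>
      Real.exp (-(1 / 3) * (2 * z.2 * z.1.1 + z.1.2 * z.2 ^ 2))) ?_).measurable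
  exact Measurable.stronglyMeasurable (by fun_prop)

/-- Substitute v = μ* - u and expand the square: the factor with u = 0 leaves the integral and
cancels the numerator. -/
theorem weight_eq_inv_invWeight (muStar ε : ℝ) (x : ℕ → ℝ) (T : ℕ) :
    weight muStar ε x T = (invWeight ε (∑ s ∈ Finset.range T, (x s - muStar)) T)⁻¹ := by
  have hshift : ∫ v in Set.Iic (muStar - ε),
        Real.exp (-(1 / 3) * ∑ s ∈ Finset.range T, (x s - v) ^ 2)
      = ∫ u in Set.Ioi ε,
        Real.exp (-(1 / 3) * ∑ s ∈ Finset.range T, (x s - (muStar - u)) ^ 2) := by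
    rw [← integral_Ici_eq_integral_Ioi]
    have := (volume.measurePreserving_sub_left muStar).setIntegral_preimage_emb
      (MeasurableEquiv.subLeft muStar).measurableEmbedding
      (fun v => Real.exp (-(1 / 3) * ∑ s ∈ Finset.range T, (x s - v) ^ 2))
      (Set.Iic (muStar - ε))
    rw [← this]
    congr 2
    ext u
    simp
  have hfac : ∀ u : ℝ, Real.exp (-(1 / 3) * ∑ s ∈ Finset.range T, (x s - (muStar - u)) ^ 2)
      = Real.exp (-(1 / 3) * ∑ s ∈ Finset.range T, (x s - muStar) ^ 2) *
        Real.exp (-(1 / 3) * (2 * u * ∑ s ∈ Finset.range T, (x s - muStar) + T * u ^ 2)) := by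
    intro u
    rw [← Real.exp_add, ← mul_add]
    congr 2
    rw [Finset.mul_sum]
    have : (T : ℝ) * u ^ 2 = ∑ s ∈ Finset.range T, u ^ 2 := by simp
    rw [this, ← Finset.sum_add_distrib, ← Finset.sum_add_distrib]
    exact Finset.sum_congr rfl fun s _ => by ring
  rw [weight, hshift, invWeight]
  simp_rw [hfac]
  rw [integral_const_mul, div_mul_eq_div_div, div_self (Real.exp_ne_zero _), one_div]

/-- For D < u ≤ 7D/6 the exponent is at least T(3uD/2 - u²)/3. The concave quadratic is D²/2 and
7D²/18 at the endpoints, both above 3D²/8. -/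
theorem le_invWeight {ε D S T : ℝ} (hε : ε ≤ D) (hD : 0 < D) (hT : 0 < T)
    (hS : S ≤ -(3 / 4) * D * T) :
    D / 6 * Real.exp (T * D ^ 2 / 8) ≤ invWeight ε S T := by
  have hsub : Set.Ioc D (7 / 6 * D) ⊆ Set.Ioi ε := fun u hu => lt_of_le_of_lt hε hu.1
  have hint := integrable_exp_invWeight S hT
  calc D / 6 * Real.exp (T * D ^ 2 / 8)
      = ∫ _ in Set.Ioc D (7 / 6 * D), Real.exp (T * D ^ 2 / 8) := by
        rw [setIntegral_const, measureReal_def, Real.volume_Ioc,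
          ENNReal.toReal_ofReal (by linarith), smul_eq_mul]
        ring
    _ ≤ ∫ u in Set.Ioc D (7 / 6 * D), Real.exp (-(1 / 3) * (2 * u * S + T * u ^ 2)) := by
        refine setIntegral_mono_on (integrableOn_const (by simp)) hint.integrableOn
          measurableSet_Ioc fun u hu => Real.exp_le_exp.2 ?_
        have hu0 : 0 < u := hD.trans hu.1
        have h1 : u * S ≤ u * (-(3 / 4) * D * T) := mul_le_mul_of_nonneg_left hS hu0.le
        have h2 : 0 ≤ (u - D) * (7 / 6 * D - u) :=
          mul_nonneg (by linarith [hu.1]) (by linarith [hu.2])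
        have h3 : 3 / 8 * D ^ 2 ≤ 3 / 2 * (u * D) - u ^ 2 := by
          nlinarith [mul_nonneg hD.le (by linarith [hu.2] : 0 ≤ 7 / 6 * D - u)]
        nlinarith [mul_le_mul_of_nonneg_left h3 hT.le]
    _ ≤ invWeight ε S T :=
        setIntegral_mono_set hint.integrableOn
          (Filter.Eventually.of_forall fun _ => (Real.exp_pos _).le) hsub.eventuallyLE

theorem sum_exp_neg_le (n : ℕ) {q : ℝ} (hq : 0 < q) :
    ∑ s ∈ Finset.Icc 1 n, Real.exp (-(s * q)) ≤ 1 / q := by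
  have hr1 : Real.exp (-q) < 1 := by simpa using hq
  have hr0 : 0 ≤ Real.exp (-q) := (Real.exp_pos _).le
  have h1 : ∑ s ∈ Finset.Icc 1 n, Real.exp (-(s * q))
      = Real.exp (-q) * ∑ s ∈ Finset.range n, Real.exp (-q) ^ s := by
    rw [← Finset.Ico_add_one_right_eq_Icc, Finset.sum_Ico_eq_sum_range, Finset.mul_sum]
    refine Finset.sum_congr (by simp) fun s _ => ?_
    rw [← pow_succ', ← Real.exp_nat_mul]
    congr 1; push_cast; ring
  rw [h1]
  calc Real.exp (-q) * ∑ s ∈ Finset.range n, Real.exp (-q) ^ s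
      ≤ Real.exp (-q) * (1 - Real.exp (-q))⁻¹ := by
        gcongr
        rw [← tsum_geometric_of_lt_one hr0 hr1]
        exact (summable_geometric_of_lt_one hr0 hr1).sum_le_tsum _ fun _ _ => by positivity
    _ ≤ 1 / q := by
        rw [← div_eq_mul_inv, div_le_div_iff₀ (by linarith) hq, Real.exp_neg]
        have := Real.add_one_le_exp q
        have hp := Real.exp_pos q
        field_simp
        linarith

/-! ### Expected reciprocal weight of a centred sub-Gaussian sum. -/

section Sums

variable {Ω : Type*} [MeasurableSpace Ω] {P : Measure Ω} [IsProbabilityMeasure P]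

omit [IsProbabilityMeasure P] in
-- The moment generating function at -2u/3 contributes 2Tu²/9, against -Tu²/3. The factor 1/3 in
-- place of the Gaussian 1/2 is what leaves a negative exponent; with 1/2 the two would cancel.
theorem integral_exp_le_of_subgaussian {S : Ω → ℝ} {T : ℕ}
    (hS : HasSubgaussianMGF S T P) (u : ℝ) :
    ∫ ω, Real.exp (-(1 / 3) * (2 * u * S ω + T * u ^ 2)) ∂P ≤ Real.exp (-(T * (u ^ 2 / 9))) := by
  have h1 : ∀ ω, Real.exp (-(1 / 3) * (2 * u * S ω + T * u ^ 2))
      = Real.exp (-(2 / 3 * u) * S ω) * Real.exp (-(T * u ^ 2) / 3) := fun ω => by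
    rw [← Real.exp_add]; congr 1; ring
  simp_rw [h1]
  rw [integral_mul_const]
  calc _ ≤ Real.exp (T * (-(2 / 3 * u)) ^ 2 / 2) * Real.exp (-(T * u ^ 2) / 3) := by
        gcongr
        simpa [mgf] using hS.mgf_le (-(2 / 3 * u))
    _ = _ := by rw [← Real.exp_add]; congr 1; ring

theorem integrable_exp_prod_of_subgaussian {S : Ω → ℝ} {T : ℕ} (hT : 1 ≤ T) (hmeas : Measurable S)
    (hS : HasSubgaussianMGF S T P) (ε : ℝ) :
    Integrable (fun z : Ω × ℝ => Real.exp (-(1 / 3) * (2 * z.2 * S z.1 + T * z.2 ^ 2)))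
      (P.prod (volume.restrict (Set.Ioi ε))) := by
  have hm : Measurable fun z : Ω × ℝ =>
      Real.exp (-(1 / 3) * (2 * z.2 * S z.1 + T * z.2 ^ 2)) := by fun_prop
  rw [integrable_prod_iff' hm.aestronglyMeasurable]
  constructor
  · refine Filter.Eventually.of_forall fun u => ?_
    refine ((hS.integrable_exp_mul (-(2 / 3 * u))).mul_const
      (Real.exp (-(T * u ^ 2) / 3))).congr (Filter.Eventually.of_forall fun ω => ?_)
    simp only
    rw [← Real.exp_add]; congr 1; ring
  · have hg : Integrable (fun u : ℝ => Real.exp (-((T : ℝ) / 9) * u ^ 2)) :=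
      integrable_exp_neg_mul_sq (by positivity)
    refine Integrable.mono' hg.integrableOn
      (hm.norm.stronglyMeasurable.integral_prod_left' (μ := P)).aestronglyMeasurable
      (Filter.Eventually.of_forall fun u => ?_)
    simp only [Real.norm_eq_abs, Real.abs_exp]
    rw [abs_of_nonneg (integral_nonneg fun _ => (Real.exp_pos _).le)]
    refine (integral_exp_le_of_subgaussian hS u).trans_eq ?_
    congr 1; ring

theorem integrable_invWeight_of_subgaussian {S : Ω → ℝ} {T : ℕ} (hT : 1 ≤ T)
    (hmeas : Measurable S) (hS : HasSubgaussianMGF S T P) (ε : ℝ) :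
    Integrable (fun ω => invWeight ε (S ω) T) P :=
  (integrable_exp_prod_of_subgaussian hT hmeas hS ε).integral_prod_left

theorem integral_invWeight_le_of_subgaussian {S : Ω → ℝ} {T : ℕ} (hT : 1 ≤ T)
    (hmeas : Measurable S) (hS : HasSubgaussianMGF S T P) (ε : ℝ) :
    ∫ ω, invWeight ε (S ω) T ∂P ≤ ∫ u in Set.Ioi ε, Real.exp (-(T * (u ^ 2 / 9))) := by
  have hint := integrable_exp_prod_of_subgaussian hT hmeas hS ε
  have hg : Integrable (fun u : ℝ => Real.exp (-(T * (u ^ 2 / 9)))) := by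
    have : Integrable (fun u : ℝ => Real.exp (-((T : ℝ) / 9) * u ^ 2)) :=
      integrable_exp_neg_mul_sq (by positivity)
    refine this.congr (Filter.Eventually.of_forall fun u => ?_)
    simp only; congr 1; ring
  unfold invWeight
  rw [integral_integral_swap hint]
  exact integral_mono hint.integral_prod_right hg.integrableOn
    fun u => integral_exp_le_of_subgaussian hS u

theorem sum_integral_invWeight_le {S : ℕ → Ω → ℝ} (hmeas : ∀ T, Measurable (S T))
    (hS : ∀ T : ℕ, HasSubgaussianMGF (S T) T P) {ε : ℝ} (hε : 0 < ε) (n : ℕ) :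
    ∑ T ∈ Finset.Icc 1 n, ∫ ω, invWeight ε (S T ω) T ∂P ≤ 9 / ε := by
  have hg : ∀ T ∈ Finset.Icc 1 n, Integrable (fun u : ℝ => Real.exp (-(T * (u ^ 2 / 9))))
      (volume.restrict (Set.Ioi ε)) := fun T hT => by
    have hT1 : 1 ≤ T := (Finset.mem_Icc.1 hT).1
    have : Integrable (fun u : ℝ => Real.exp (-((T : ℝ) / 9) * u ^ 2)) :=
      integrable_exp_neg_mul_sq (by positivity)
    refine this.integrableOn.congr (Filter.Eventually.of_forall fun u => ?_)
    simp only; congr 1; ring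
  calc _ ≤ ∑ T ∈ Finset.Icc 1 n, ∫ u in Set.Ioi ε, Real.exp (-(T * (u ^ 2 / 9))) :=
        Finset.sum_le_sum fun T hT => integral_invWeight_le_of_subgaussian
          (Finset.mem_Icc.1 hT).1 (hmeas T) (hS T) ε
    _ = ∫ u in Set.Ioi ε, ∑ T ∈ Finset.Icc 1 n, Real.exp (-(T * (u ^ 2 / 9))) :=
        (integral_finsetSum _ hg).symm
    -- Summing over `T` inside the integral gives a geometric series bounded by 9/u², uniformly in
    -- `n`.
    _ ≤ ∫ u in Set.Ioi ε, 9 * u ^ (-2 : ℝ) := by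
        refine setIntegral_mono_on (integrable_finsetSum _ hg)
          ((integrableOn_Ioi_rpow_of_lt (by norm_num) hε).const_mul 9) measurableSet_Ioi
          fun u hu => ?_
        have hu0 : 0 < u := hε.trans hu
        refine (sum_exp_neg_le n (q := u ^ 2 / 9) (by positivity)).trans_eq ?_
        rw [Real.rpow_neg hu0.le, Real.rpow_ofNat]
        field_simp
    _ = 9 / ε := by
        rw [integral_const_mul, integral_Ioi_rpow_of_lt (by norm_num) hε]
        norm_num
        rw [Real.rpow_neg_one, div_eq_mul_inv]

end Sums

/-! ### Concentration of reward sums. -/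

section Rewards

variable {K : ℕ} {ν : Fin K → Measure ℝ} {muStar ε : ℝ}
  {Ω : Type*} [MeasurableSpace Ω] {P : Measure Ω} [IsProbabilityMeasure P]
  {X : Fin K → ℕ → Ω → ℝ}

omit [IsProbabilityMeasure P] in
theorem IsRewardTable.hasSubgaussianMGF_sum (hν : IsBPR ν muStar ε) (hX : IsRewardTable P ν X)
    (i : Fin K) (T : ℕ) :
    HasSubgaussianMGF (fun ω => ∑ s ∈ Finset.range T, (X i s ω - mean ν i)) T P := by
  have hind : iIndepFun (fun s ω => X i s ω - mean ν i) P :=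
    (hX.indep.precomp (g := fun s : ℕ => (i, s)) fun a b h => (Prod.ext_iff.1 h).2).comp
      (fun _ x => x - mean ν i) fun _ => measurable_id.sub_const _
  have hsub : ∀ s, HasSubgaussianMGF (fun ω => X i s ω - mean ν i) 1 P := fun s =>
    HasSubgaussianMGF.of_map (X := fun x => x - mean ν i) (hX.measurable i s).aemeasurable
      (by rw [hX.law i s]; exact hν.subGaussian i)
  simpa using HasSubgaussianMGF.sum_of_iIndepFun hind (c := fun _ => 1)
    (s := Finset.range T) fun s _ => hsub s

theorem IsRewardTable.measureReal_sum_gt_le (hν : IsBPR ν muStar ε) (hX : IsRewardTable P ν X)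
    (i : Fin K) {D : ℝ} (hD : D = muStar - mean ν i) (hD0 : 0 < D) {T : ℕ} (hT : 1 ≤ T) :
    P.real {ω | -(3 / 4) * D * T < ∑ s ∈ Finset.range T, (X i s ω - muStar)}
      ≤ Real.exp (-(T * (D ^ 2 / 32))) := by
  have hT0 : (0 : ℝ) < T := by exact_mod_cast hT
  -- The threshold lies DT/4 above the mean -DT, and (DT/4)²/(2T) = TD²/32.
  have h := (hX.hasSubgaussianMGF_sum hν i T).measure_ge_le (ε := D * T / 4) (by positivity)
  calc _ ≤ P.real {ω | D * T / 4 ≤ ∑ s ∈ Finset.range T, (X i s ω - mean ν i)} := by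
        refine measureReal_mono fun ω hω => ?_
        simp only [Set.mem_ofPred_eq, Finset.sum_sub_distrib, Finset.sum_const, Finset.card_range,
          nsmul_eq_mul] at hω ⊢
        have : (T : ℝ) * muStar = T * D + T * mean ν i := by rw [hD]; ring
        linarith
    _ ≤ _ := h
    _ = _ := by
        congr 1
        simp only [NNReal.coe_natCast]
        field_simp
        ring

end Rewards

/-! ### Counting pulls along one trajectory. -/

section Counting

variable {K : ℕ} (a : ℕ → Fin K)

theorem pulls_succ (t : ℕ) (i : Fin K) :
    pulls a (t + 1) i = pulls a t i + if a t = i then 1 else 0 := by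
  unfold pulls
  rw [Finset.range_add_one, Finset.filter_insert]
  split_ifs with h
  · rw [Finset.card_insert_of_notMem (by simp)]
  · simp

theorem pulls_le (t : ℕ) (i : Fin K) : pulls a t i ≤ t :=
  (Finset.card_filter_le _ _).trans_eq (Finset.card_range t)

/-- The count of an arm rises by one exactly when it is pulled, so its values just before those
pulls run through 0, 1, 2, … without repetition. -/
theorem sum_range_pulls (f : ℕ → ℝ) (t : ℕ) (i : Fin K) :
    ∑ r ∈ Finset.range (pulls a t i), f r
      = ∑ s ∈ Finset.range t, if a s = i then f (pulls a s i) else 0 := by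
  induction t with
  | zero => simp [pulls]
  | succ t ih =>
    rw [Finset.sum_range_succ, ← ih, pulls_succ]
    split_ifs with h
    · rw [Finset.sum_range_succ]
    · simp

theorem sum_pulls_le {f : ℕ → ℝ} (hf : ∀ r, 0 ≤ f r) (hf0 : f 0 = 0) (n : ℕ) (i : Fin K) :
    ∑ t ∈ Finset.range n, (if a t = i then f (pulls a t i) else 0)
      ≤ ∑ T ∈ Finset.Icc 1 n, f T := by
  rw [← sum_range_pulls]
  calc _ ≤ ∑ r ∈ Finset.range (n + 1), f r :=
        Finset.sum_le_sum_of_subset_of_nonneg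
          (Finset.range_subset_range.2 ((pulls_le a n i).trans n.le_succ)) fun r _ _ => hf r
    _ = _ := by
        rw [Finset.sum_range_succ', hf0, add_zero, ← Finset.Ico_add_one_right_eq_Icc,
          Finset.sum_Ico_eq_sum_range]
        refine Finset.sum_congr (by simp) fun s _ => by rw [add_comm]

theorem pulls_pos {t s : ℕ} (hs : s < t) : 0 < pulls a t (a s) :=
  Finset.card_pos.2 ⟨s, by simp [hs]⟩

theorem exists_lt_of_pulls_pos {t : ℕ} {i : Fin K} (h : 0 < pulls a t i) :
    ∃ s < t, a s = i := by
  obtain ⟨s, hs⟩ := Finset.card_pos.1 h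
  exact ⟨s, by simpa using hs⟩

/-- Each pull is classified by the preceding count: below `l`, bad, or neither. A count not below
`l` is at least 1 by `hl`, so count 0 is never needed in the bad sum. -/
theorem pulls_le_add_sum (l n : ℕ) (i : Fin K) (hl : 1 ≤ l) (bad : ℕ → Prop)
    [DecidablePred bad] :
    (pulls a n i : ℝ) ≤ l + (∑ T ∈ Finset.Icc 1 n, if bad T then 1 else 0)
      + ∑ t ∈ Finset.range n,
        if a t = i ∧ l ≤ pulls a t i ∧ ¬ bad (pulls a t i) then 1 else 0 := by
  have h1 : ∑ t ∈ Finset.range n, (if a t = i then (if pulls a t i < l then (1 : ℝ) else 0) else 0)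
      ≤ l := by
    rw [← sum_range_pulls a (fun r => if r < l then (1 : ℝ) else 0), Finset.sum_boole]
    have : ((Finset.range (pulls a n i)).filter (fun r => r < l)).card ≤ (Finset.range l).card :=
      Finset.card_le_card fun r hr => by simp at hr ⊢; exact hr.2
    rw [Finset.card_range] at this
    exact_mod_cast this
  have h2 := sum_pulls_le a (f := fun r => if 1 ≤ r ∧ bad r then (1 : ℝ) else 0)
    (fun r => by positivity) (by simp) n i
  have h3 : ∑ T ∈ Finset.Icc 1 n, (if 1 ≤ T ∧ bad T then (1 : ℝ) else 0)
      = ∑ T ∈ Finset.Icc 1 n, if bad T then 1 else 0 :=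
    Finset.sum_congr rfl fun T hT => by simp [(Finset.mem_Icc.1 hT).1]
  have h4 : (pulls a n i : ℝ) = ∑ t ∈ Finset.range n, if a t = i then (1 : ℝ) else 0 := by
    rw [Finset.sum_boole]; rfl
  rw [h3] at h2
  refine le_trans ?_ (add_le_add (add_le_add h1 h2) le_rfl)
  rw [h4, ← Finset.sum_add_distrib, ← Finset.sum_add_distrib]
  refine Finset.sum_le_sum fun t _ => ?_
  by_cases hi : a t = i
  · by_cases hlt : pulls a t i < l
    · simp only [hi, hlt, if_true]
      have : (0 : ℝ) ≤ if 1 ≤ pulls a t i ∧ bad (pulls a t i) then 1 else 0 := by positivity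
      have : (0 : ℝ) ≤ if True ∧ l ≤ pulls a t i ∧ ¬ bad (pulls a t i) then 1 else 0 := by
        positivity
      linarith
    · push Not at hlt
      by_cases hb : bad (pulls a t i)
      · simp [hi, hlt.not_gt, hlt, hb, hl.trans hlt]
      · simp [hi, hlt.not_gt, hlt, hb]
  · simp [hi]

end Counting

/-! ### Measurability with respect to the history, and conditional sampling. -/

section History

variable {K : ℕ} {ν : Fin K → Measure ℝ} {muStar ε : ℝ}
  {Ω : Type*} [MeasurableSpace Ω] {P : Measure Ω}
  {X : Fin K → ℕ → Ω → ℝ} {I : ℕ → Ω → Fin K}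

omit [MeasurableSpace Ω] in
theorem pulls_eq_sum_history (t : ℕ) (i : Fin K) (ω : Ω) :
    (pulls (fun s => I s ω) t i : ℝ) =
      ∑ s : Fin t, if (history X I t ω s).1 = i then (1 : ℝ) else 0 := by
  change _ = ∑ s : Fin t, if I s ω = i then (1 : ℝ) else 0
  rw [Fin.sum_univ_eq_sum_range (fun s => if I s ω = i then (1 : ℝ) else 0) t, Finset.sum_boole]
  rfl

omit [MeasurableSpace Ω] in
theorem sum_rewards_eq_sum_history (t : ℕ) (i : Fin K) (ω : Ω) :
    ∑ r ∈ Finset.range (pulls (fun s => I s ω) t i), (X i r ω - muStar) =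
      ∑ s : Fin t, if (history X I t ω s).1 = i then (history X I t ω s).2 - muStar else 0 := by
  change _ = ∑ s : Fin t, if I s ω = i then reward X I s ω - muStar else 0
  rw [Fin.sum_univ_eq_sum_range (fun s => if I s ω = i then reward X I s ω - muStar else 0) t,
    sum_range_pulls (fun s => I s ω) (fun r => X i r ω - muStar)]
  refine Finset.sum_congr rfl fun s _ => ?_
  split_ifs with h
  · simp [reward, h]
  · rfl

omit [MeasurableSpace Ω] in
theorem measurable_comap_pulls (t : ℕ) (i : Fin K) :
    Measurable[MeasurableSpace.comap (history X I t) inferInstance]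
      fun ω => (pulls (fun s => I s ω) t i : ℝ) := by
  have h : Measurable fun h : Fin t → Fin K × ℝ => ∑ s : Fin t, if (h s).1 = i then (1 : ℝ) else 0 :=
    Finset.measurable_sum _ fun s _ =>
      Measurable.ite ((measurable_pi_apply s).fst (measurableSet_singleton i)) measurable_const
        measurable_const
  simp_rw [pulls_eq_sum_history (X := X)]
  exact h.comp (comap_measurable _)

omit [MeasurableSpace Ω] in
theorem measurable_comap_sum_rewards (muStar : ℝ) (t : ℕ) (i : Fin K) :
    Measurable[MeasurableSpace.comap (history X I t) inferInstance]
      fun ω => ∑ r ∈ Finset.range (pulls (fun s => I s ω) t i), (X i r ω - muStar) := by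
  have h : Measurable fun h : Fin t → Fin K × ℝ =>
      ∑ s : Fin t, if (h s).1 = i then (h s).2 - muStar else 0 :=
    Finset.measurable_sum _ fun s _ =>
      Measurable.ite ((measurable_pi_apply s).fst (measurableSet_singleton i))
        ((measurable_pi_apply s).snd.sub_const _) measurable_const
  simp_rw [sum_rewards_eq_sum_history]
  exact h.comp (comap_measurable _)

theorem measurable_pulls (hI : ∀ t, Measurable (I t)) (t : ℕ) (i : Fin K) :
    Measurable fun ω => pulls (fun s => I s ω) t i := by
  induction t with
  | zero => simp [pulls]
  | succ t ih =>
    simp_rw [pulls_succ]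
    exact ih.add (Measurable.ite (hI t (measurableSet_singleton i)) measurable_const
      measurable_const)

theorem measurable_reward (hX : ∀ i s, Measurable (X i s)) (hI : ∀ t, Measurable (I t)) (t : ℕ) :
    Measurable (reward X I t) := by
  have hX' : Measurable fun z : (Fin K × ℕ) × Ω => X z.1.1 z.1.2 z.2 :=
    measurable_from_prod_countable_right fun q => hX q.1 q.2
  have hp : Measurable fun z : Fin K × Ω => pulls (fun s => I s z.2) t z.1 :=
    measurable_from_prod_countable_right fun i => measurable_pulls hI t i
  exact hX'.comp (((hI t).prodMk (hp.comp ((hI t).prodMk measurable_id))).prodMk measurable_id)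

theorem comap_history_le (hX : ∀ i s, Measurable (X i s)) (hI : ∀ t, Measurable (I t)) (t : ℕ) :
    MeasurableSpace.comap (history X I t) inferInstance ≤ ‹MeasurableSpace Ω› :=
  Measurable.comap_le (measurable_pi_lambda _ fun s =>
    (hI s).prodMk (measurable_reward hX hI s))

variable [IsProbabilityMeasure P]

/-- A history-measurable factor passes through the conditional expectation. This trades sampling
probabilities for indicators of actual pulls, for the suboptimal and the best arm alike. -/
theorem condExp_mul_indicator (hX : IsRewardTable P ν X) (hI : IsPolicyRun P muStar ε X I)
    {t : ℕ} (ht : K ≤ t) (j : Fin K) {h : Ω → ℝ}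
    (hh : Measurable[MeasurableSpace.comap (history X I t) inferInstance] h)
    (hint : Integrable h P) :
    Integrable (fun ω => h ω * prob muStar ε X I t j ω) P ∧
    ∫ ω, h ω * prob muStar ε X I t j ω ∂P = ∫ ω, (if I t ω = j then h ω else 0) ∂P := by
  have hset : MeasurableSet (I t ⁻¹' {j}) := hI.measurable t (measurableSet_singleton j)
  have heq : (h * (I t ⁻¹' {j}).indicator fun _ => (1 : ℝ)) = (I t ⁻¹' {j}).indicator h := by
    ext ω; by_cases hω : I t ω = j <;> simp [hω]
  have key : P[(I t ⁻¹' {j}).indicator h | MeasurableSpace.comap (history X I t) inferInstance]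
      =ᵐ[P] fun ω => h ω * prob muStar ε X I t j ω := by
    rw [← heq]
    refine (condExp_mul_of_stronglyMeasurable_left hh.stronglyMeasurable
      (by rw [heq]; exact hint.indicator hset) ((integrable_const 1).indicator hset)).trans ?_
    filter_upwards [hI.sample t ht j] with ω hω
    simp only [Pi.mul_apply]
    rw [hω]
  refine ⟨integrable_condExp.congr key, ?_⟩
  rw [← integral_congr_ae key, integral_condExp (comap_history_le hX.measurable hI.measurable t)]
  refine integral_congr_ae (Filter.Eventually.of_forall fun ω => ?_)
  by_cases hω : I t ω = j <;> simp [hω]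

end History

/-! ### Expected number of pulls under the policy. -/

section Policy

variable {K : ℕ} {ν : Fin K → Measure ℝ} {muStar ε : ℝ}
  {Ω : Type*} [MeasurableSpace Ω] {P : Measure Ω}
  {X : Fin K → ℕ → Ω → ℝ} {I : ℕ → Ω → Fin K}

theorem IsBPR.iSup_mean (hν : IsBPR ν muStar ε) : ⨆ j, mean ν j = muStar := by
  obtain ⟨b, hb, hother⟩ := hν.best
  have : Nonempty (Fin K) := ⟨b⟩
  refine le_antisymm (ciSup_le fun j => ?_) (hb ▸ le_ciSup (Set.finite_range _).bddAbove b)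
  by_cases hj : j = b
  · rw [hj, hb]
  · linarith [hother j hj, hν.eps_pos]

theorem IsPolicyRun.pulls_pos (hI : IsPolicyRun P muStar ε X I) {t : ℕ} (ht : K ≤ t) (j : Fin K)
    (ω : Ω) : 0 < pulls (fun s => I s ω) t j := by
  have h : I j ω = j := Fin.ext (hI.init j j.2 ω)
  have := Bandit.pulls_pos (fun s => I s ω) (j.2.trans_le ht)
  simpa [h] using this

theorem IsPolicyRun.pulls_eq_zero (hI : IsPolicyRun P muStar ε X I) {t : ℕ} (ht : t < K)
    (ω : Ω) : pulls (fun s => I s ω) t (I t ω) = 0 := by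
  by_contra h
  obtain ⟨s, hs, hs'⟩ := exists_lt_of_pulls_pos _ (Nat.pos_of_ne_zero h)
  have h1 := hI.init t ht ω
  have h2 := hI.init s (hs.trans ht) ω
  have h3 : (I s ω : ℕ) = I t ω := congrArg Fin.val hs'
  omega

theorem weight_nonneg (muStar ε : ℝ) (x : ℕ → ℝ) (T : ℕ) : 0 ≤ weight muStar ε x T := by
  rw [weight_eq_inv_invWeight]
  exact inv_nonneg.2 (invWeight_nonneg _ _ _)

omit [MeasurableSpace Ω] in
-- The normalizer is common, so p(i)/w(i) = p(b)/w(b), and 1/w(b) is the reciprocal weight of `b`,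
-- nonzero once `b` has been pulled.
theorem prob_le_mul_prob (muStar ε : ℝ) (X : Fin K → ℕ → Ω → ℝ) (I : ℕ → Ω → Fin K) {t : ℕ}
    (b i : Fin K) (ω : Ω) (hb : 0 < pulls (fun s => I s ω) t b) {C : ℝ}
    (hC : weight muStar ε (fun s => X i s ω) (pulls (fun s => I s ω) t i) ≤ C) :
    prob muStar ε X I t i ω ≤
      C * (invWeight ε (∑ r ∈ Finset.range (pulls (fun s => I s ω) t b), (X b r ω - muStar))
        (pulls (fun s => I s ω) t b) * prob muStar ε X I t b ω) := by
  unfold prob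
  set Z := ∑ j, weight muStar ε (fun s => X j s ω) (pulls (fun s => I s ω) t j) with hZ
  have hZ0 : 0 ≤ Z := Finset.sum_nonneg fun j _ => weight_nonneg _ _ _ _
  rw [weight_eq_inv_invWeight muStar ε (fun s => X b s ω)]
  rw [← mul_div_assoc, mul_inv_cancel₀ (invWeight_pos ε _ (by exact_mod_cast hb)).ne',
    mul_one_div]
  gcongr

theorem weight_le_of_sum_le {D : ℝ} (hε : 0 < ε) (hD : ε ≤ D) {x : ℕ → ℝ} {T : ℕ}
    (hT : 8 * (1 + Real.log (D / ε)) / D ^ 2 ≤ T) (hT1 : 1 ≤ T)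
    (hS : ∑ s ∈ Finset.range T, (x s - muStar) ≤ -(3 / 4) * D * T) :
    weight muStar ε x T ≤ 3 * ε / D ^ 2 := by
  have hD0 : 0 < D := hε.trans_le hD
  rw [weight_eq_inv_invWeight]
  have h := le_invWeight hD hD0 (by exact_mod_cast hT1) hS
  -- The lower bound on `T` gives exp(TD²/8) ≥ e·D/ε, and e ≥ 2.
  have h2 : 2 * (D / ε) ≤ Real.exp (T * D ^ 2 / 8) := by
    rw [div_le_iff₀ (by positivity)] at hT
    calc 2 * (D / ε) ≤ Real.exp 1 * Real.exp (Real.log (D / ε)) := by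
          rw [Real.exp_log (by positivity)]
          gcongr
          linarith [Real.add_one_le_exp (1 : ℝ)]
      _ = Real.exp (1 + Real.log (D / ε)) := (Real.exp_add _ _).symm
      _ ≤ _ := Real.exp_le_exp.2 (by linarith)
  have h3 : D ^ 2 / (3 * ε) ≤ invWeight ε (∑ s ∈ Finset.range T, (x s - muStar)) T :=
    calc D ^ 2 / (3 * ε) = D / 6 * (2 * (D / ε)) := by field_simp; ring
      _ ≤ D / 6 * Real.exp (T * D ^ 2 / 8) := by gcongr
      _ ≤ _ := h
  calc _ ≤ (D ^ 2 / (3 * ε))⁻¹ := inv_anti₀ (by positivity) h3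
    _ = _ := inv_div _ _

variable [IsProbabilityMeasure P]

/-- Pulls of a suboptimal arm at times when its weight is small are rare, since the best arm's
inverse weights have bounded total expectation. -/
theorem sum_integral_good_pulls_le (hν : IsBPR ν muStar ε) (hX : IsRewardTable P ν X)
    (hI : IsPolicyRun P muStar ε X I) {b : Fin K} (hb : mean ν b = muStar) (i : Fin K)
    {D : ℝ} (hD : ε ≤ D) {l : ℕ} (hl1 : 1 ≤ l)
    (hl : 8 * (1 + Real.log (D / ε)) / D ^ 2 ≤ l) (n : ℕ) :
    ∑ t ∈ Finset.range n, ∫ ω, (if I t ω = i ∧ l ≤ pulls (fun s => I s ω) t i ∧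
        ¬ (-(3 / 4) * D * pulls (fun s => I s ω) t i <
          ∑ r ∈ Finset.range (pulls (fun s => I s ω) t i), (X i r ω - muStar))
        then (1 : ℝ) else 0) ∂P ≤ 27 / D ^ 2 := by
  have hε := hν.eps_pos
  have hD0 : 0 < D := hε.trans_le hD
  set S : ℕ → Ω → ℝ := fun T ω => ∑ r ∈ Finset.range T, (X b r ω - muStar) with hSdef
  have hSm : ∀ T, Measurable (S T) := fun T =>
    Finset.measurable_sum _ fun r _ => (hX.measurable b r).sub_const _
  have hSsub : ∀ T : ℕ, HasSubgaussianMGF (S T) T P := fun T => by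
    have := hX.hasSubgaussianMGF_sum hν b T
    rwa [hb] at this
  set N : ℕ → Ω → ℕ := fun t ω => pulls (fun s => I s ω) t b with hN
  -- At T = 0 the integral diverges; the guard sets that term to 0, as `sum_pulls_le` requires.
  set F : ℕ → Ω → ℝ := fun T ω => if 1 ≤ T then invWeight ε (S T ω) T else 0 with hF
  have hF0 : ∀ T ω, 0 ≤ F T ω := fun T ω => by
    simp only [hF]; split_ifs
    · exact invWeight_nonneg _ _ _
    · exact le_rfl
  have hFint : ∀ T, Integrable (F T) P := fun T => by
    by_cases hT : 1 ≤ T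
    · simpa [hF, hT] using integrable_invWeight_of_subgaussian hT (hSm T) (hSsub T) ε
    · simp [hF, hT]
  have hFsum : ∑ T ∈ Finset.Icc 1 n, ∫ ω, F T ω ∂P ≤ 9 / ε := by
    refine le_trans (le_of_eq ?_) (sum_integral_invWeight_le hSm hSsub hε n)
    refine Finset.sum_congr rfl fun T hT => ?_
    simp [hF, (Finset.mem_Icc.1 hT).1]
  have hgmeas : ∀ t, Measurable[MeasurableSpace.comap (history X I t) inferInstance]
      fun ω => invWeight ε (S (N t ω) ω) (N t ω) := fun t =>
    (measurable_invWeight ε).comp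
      ((measurable_comap_sum_rewards muStar t b).prodMk (measurable_comap_pulls t b))
  have hgF : ∀ t, K ≤ t → ∀ ω, invWeight ε (S (N t ω) ω) (N t ω) = F (N t ω) ω :=
    fun t ht ω => by
      have : 1 ≤ N t ω := hI.pulls_pos ht b ω
      simp [hF, this]
  have hle := comap_history_le hX.measurable hI.measurable
  have hgint : ∀ t, K ≤ t → Integrable (fun ω => invWeight ε (S (N t ω) ω) (N t ω)) P :=
    fun t ht => by
      refine (integrable_finsetSum (Finset.range (t + 1)) fun T _ => hFint T).mono'
        ((hgmeas t).mono (hle t) le_rfl).aestronglyMeasurable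
        (Filter.Eventually.of_forall fun ω => ?_)
      rw [Real.norm_of_nonneg (invWeight_nonneg _ _ _), hgF t ht]
      exact Finset.single_le_sum (f := fun T => F T ω) (fun T _ => hF0 T ω)
        (Finset.mem_range.2 (Nat.lt_succ_of_le (pulls_le _ t b)))
  have hFind : ∀ t, Integrable (fun ω => if I t ω = b then F (N t ω) ω else 0) P := fun t => by
    refine (integrable_finsetSum (Finset.range (t + 1)) fun T _ => hFint T).mono' ?_
      (Filter.Eventually.of_forall fun ω => ?_)
    · have hFm : Measurable fun z : ℕ × Ω => F z.1 z.2 :=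
        measurable_from_prod_countable_right fun T => by
          by_cases hT : 1 ≤ T
          · simp only [hF, hT, if_true]
            exact (measurable_invWeight ε).comp ((hSm T).prodMk measurable_const)
          · simp [hF, hT]
      exact (Measurable.ite (hI.measurable t (measurableSet_singleton b))
        (hFm.comp ((measurable_pulls hI.measurable t b).prodMk measurable_id))
        measurable_const).aestronglyMeasurable
    · have h1 : F (N t ω) ω ≤ ∑ T ∈ Finset.range (t + 1), F T ω :=
        Finset.single_le_sum (f := fun T => F T ω) (fun T _ => hF0 T ω)
          (Finset.mem_range.2 (Nat.lt_succ_of_le (pulls_le _ t b)))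
      split_ifs
      · rwa [Real.norm_of_nonneg (hF0 _ _)]
      · simpa using (hF0 _ _).trans h1
  have hstep : ∀ t, ∫ ω, (if I t ω = i ∧ l ≤ pulls (fun s => I s ω) t i ∧
        ¬ (-(3 / 4) * D * pulls (fun s => I s ω) t i <
          ∑ r ∈ Finset.range (pulls (fun s => I s ω) t i), (X i r ω - muStar))
        then (1 : ℝ) else 0) ∂P
      ≤ 3 * ε / D ^ 2 * ∫ ω, (if I t ω = b then F (N t ω) ω else 0) ∂P := fun t => by
    rcases lt_or_ge t K with ht | ht
    · have hz : ∀ ω, (if I t ω = i ∧ l ≤ pulls (fun s => I s ω) t i ∧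
          ¬ (-(3 / 4) * D * pulls (fun s => I s ω) t i <
            ∑ r ∈ Finset.range (pulls (fun s => I s ω) t i), (X i r ω - muStar))
          then (1 : ℝ) else 0) = 0 := fun ω => by
        refine if_neg fun h => ?_
        have := hI.pulls_eq_zero ht ω
        rw [h.1] at this
        have := h.2.1
        omega
      simp_rw [hz]
      rw [integral_zero]
      refine mul_nonneg (by positivity) (integral_nonneg fun ω => ?_)
      show (0 : ℝ) ≤ if _ then _ else _
      split_ifs
      · exact hF0 _ _
      · exact le_rfl
    · classical
      set A : Set Ω := {ω | (l : ℝ) ≤ (pulls (fun s => I s ω) t i : ℝ) ∧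
        ∑ r ∈ Finset.range (pulls (fun s => I s ω) t i), (X i r ω - muStar) ≤
          -(3 / 4) * D * (pulls (fun s => I s ω) t i : ℝ)} with hA
      have hAm : MeasurableSet[MeasurableSpace.comap (history X I t) inferInstance] A := by
        have h1 := measurable_comap_pulls (X := X) (I := I) t i
        have h2 := measurable_comap_sum_rewards (X := X) (I := I) muStar t i
        exact (measurableSet_le measurable_const h1).inter
          (measurableSet_le h2 (measurable_const.mul h1))
      obtain ⟨hi1, hi2⟩ := condExp_mul_indicator hX hI ht i
        (h := A.indicator fun _ => (1 : ℝ)) (measurable_const.indicator hAm)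
        ((integrable_const 1).indicator (hle t _ hAm))
      obtain ⟨hb1, hb2⟩ := condExp_mul_indicator hX hI ht b (hgmeas t) (hgint t ht)
      calc _ = ∫ ω, (if I t ω = i then A.indicator (fun _ => (1 : ℝ)) ω else 0) ∂P := by
            refine integral_congr_ae (Filter.Eventually.of_forall fun ω => ?_)
            simp [Set.indicator_apply, hA, ite_and]
        _ = ∫ ω, A.indicator (fun _ => (1 : ℝ)) ω * prob muStar ε X I t i ω ∂P := hi2.symm
        _ ≤ ∫ ω, 3 * ε / D ^ 2 *
              (invWeight ε (S (N t ω) ω) (N t ω) * prob muStar ε X I t b ω) ∂P := by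
            refine integral_mono hi1 (hb1.const_mul _) fun ω => ?_
            have hprob : 0 ≤ prob muStar ε X I t b ω :=
              div_nonneg (weight_nonneg _ _ _ _) (Finset.sum_nonneg fun j _ => weight_nonneg _ _ _ _)
            by_cases hω : ω ∈ A
            · simp only [Set.indicator_of_mem hω, one_mul]
              refine prob_le_mul_prob muStar ε X I b i ω (hI.pulls_pos ht b ω) ?_
              refine weight_le_of_sum_le hε hD (hl.trans hω.1) ?_ hω.2
              exact hl1.trans (by exact_mod_cast hω.1)
            · simp only [Set.indicator_of_notMem hω, zero_mul]
              exact mul_nonneg (by positivity) (mul_nonneg (invWeight_nonneg _ _ _) hprob)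
        _ = 3 * ε / D ^ 2 * ∫ ω, (if I t ω = b then F (N t ω) ω else 0) ∂P := by
            rw [integral_const_mul, hb2]
            simp_rw [hgF t ht]
  calc _ ≤ ∑ t ∈ Finset.range n,
        3 * ε / D ^ 2 * ∫ ω, (if I t ω = b then F (N t ω) ω else 0) ∂P :=
        Finset.sum_le_sum fun t _ => hstep t
    _ = 3 * ε / D ^ 2 * ∫ ω, ∑ t ∈ Finset.range n, (if I t ω = b then F (N t ω) ω else 0) ∂P := by
        rw [← Finset.mul_sum, integral_finsetSum _ fun t _ => hFind t]
    -- Pulls of `b` have distinct counts, so the random times disappear from the sum.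
    _ ≤ 3 * ε / D ^ 2 * ∫ ω, ∑ T ∈ Finset.Icc 1 n, F T ω ∂P := by
        refine mul_le_mul_of_nonneg_left (integral_mono
          (integrable_finsetSum _ fun t _ => hFind t)
          (integrable_finsetSum _ fun T _ => hFint T) fun ω => ?_) (by positivity)
        exact sum_pulls_le (fun s => I s ω) (f := fun T => F T ω) (fun T => hF0 T ω)
          (by simp [hF]) n b
    _ ≤ 3 * ε / D ^ 2 * (9 / ε) := by
        rw [integral_finsetSum _ fun T _ => hFint T]
        gcongr
    _ = 27 / D ^ 2 := by field_simp; norm_num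

theorem integrable_pulls (hI : IsPolicyRun P muStar ε X I) (n : ℕ) (i : Fin K) :
    Integrable (fun ω => (pulls (fun s => I s ω) n i : ℝ)) P := by
  refine Integrable.of_bound (C := n)
    (measurable_from_top.comp (measurable_pulls hI.measurable n i)).aestronglyMeasurable
    (Filter.Eventually.of_forall fun ω => ?_)
  rw [Real.norm_of_nonneg (by positivity)]
  exact_mod_cast pulls_le _ n i

theorem integral_pulls_le (hν : IsBPR ν muStar ε) (hX : IsRewardTable P ν X)
    (hI : IsPolicyRun P muStar ε X I) {i : Fin K} {D : ℝ} (hDdef : D = muStar - mean ν i)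
    (hD : ε ≤ D) (n : ℕ) :
    ∫ ω, (pulls (fun s => I s ω) n i : ℝ) ∂P ≤ 1 + (80 + 8 * Real.log (D / ε)) / D ^ 2 := by
  classical
  obtain ⟨b, hb, -⟩ := hν.best
  have hε := hν.eps_pos
  have hD0 : 0 < D := hε.trans_le hD
  have hL : 0 ≤ Real.log (D / ε) := Real.log_nonneg ((one_le_div hε).2 hD)
  set l := ⌈8 * (1 + Real.log (D / ε)) / D ^ 2⌉₊ with hldef
  have hl : 8 * (1 + Real.log (D / ε)) / D ^ 2 ≤ l := Nat.le_ceil _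
  have hl1 : 1 ≤ l := Nat.ceil_pos.2 (by positivity)
  -- Rounding up costs the 1 that becomes the summand Δ_i of the regret bound.
  have hl2 : (l : ℝ) ≤ 8 * (1 + Real.log (D / ε)) / D ^ 2 + 1 :=
    (Nat.ceil_lt_add_one (by positivity)).le
  set Z : ℕ → Ω → ℝ := fun T ω => ∑ r ∈ Finset.range T, (X i r ω - muStar) with hZ
  have hZm : ∀ T, Measurable (Z T) := fun T =>
    Finset.measurable_sum _ fun r _ => (hX.measurable i r).sub_const _
  have hbadset : ∀ T, MeasurableSet {ω | -(3 / 4) * D * T < Z T ω} := fun T =>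
    measurableSet_lt measurable_const (hZm T)
  have hbadint : ∀ T : ℕ, Integrable (fun ω => if -(3 / 4) * D * T < Z T ω then (1 : ℝ) else 0) P :=
    fun T => Integrable.of_bound (C := 1)
      (Measurable.ite (hbadset T) measurable_const measurable_const).aestronglyMeasurable
      (Filter.Eventually.of_forall fun ω => by split_ifs <;> simp)
  have hgoodint : ∀ t, Integrable (fun ω => if I t ω = i ∧ l ≤ pulls (fun s => I s ω) t i ∧
        ¬ (-(3 / 4) * D * pulls (fun s => I s ω) t i < Z (pulls (fun s => I s ω) t i) ω)
        then (1 : ℝ) else 0) P := fun t => by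
    have hp := measurable_pulls hI.measurable t i
    have hpr : Measurable fun ω => (pulls (fun s => I s ω) t i : ℝ) := measurable_from_top.comp hp
    have hZp : Measurable fun ω => Z (pulls (fun s => I s ω) t i) ω :=
      (measurable_from_prod_countable_right (f := fun z : ℕ × Ω => Z z.1 z.2) hZm).comp
        (hp.prodMk measurable_id)
    refine Integrable.of_bound (C := 1) (Measurable.ite ?_ measurable_const
      measurable_const).aestronglyMeasurable
      (Filter.Eventually.of_forall fun ω => by split_ifs <;> simp)
    exact (hI.measurable t (measurableSet_singleton i)).inter
      ((measurableSet_le measurable_const hp).inter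
        (measurableSet_lt (measurable_const.mul hpr) hZp).compl)
  have hbad : ∑ T ∈ Finset.Icc 1 n, ∫ ω, (if -(3 / 4) * D * T < Z T ω then (1 : ℝ) else 0) ∂P
      ≤ 32 / D ^ 2 := by
    calc _ ≤ ∑ T ∈ Finset.Icc 1 n, Real.exp (-(T * (D ^ 2 / 32))) := by
          refine Finset.sum_le_sum fun T hT => ?_
          refine le_trans (le_of_eq ?_)
            (hX.measureReal_sum_gt_le hν i hDdef hD0 (Finset.mem_Icc.1 hT).1)
          rw [← integral_indicator_one (hbadset T)]
          refine integral_congr_ae (Filter.Eventually.of_forall fun ω => ?_)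
          simp [Set.indicator_apply]
      _ ≤ 1 / (D ^ 2 / 32) := sum_exp_neg_le n (by positivity)
      _ = _ := by rw [one_div_div]
  have hfirst : Integrable (fun ω => (l : ℝ) +
      ∑ T ∈ Finset.Icc 1 n, if -(3 / 4) * D * T < Z T ω then (1 : ℝ) else 0) P :=
    (integrable_const _).add (integrable_finsetSum _ fun T _ => hbadint T)
  have hgood := sum_integral_good_pulls_le hν hX hI hb i hD hl1 hl n
  calc ∫ ω, (pulls (fun s => I s ω) n i : ℝ) ∂P
      ≤ ∫ ω, (l + (∑ T ∈ Finset.Icc 1 n, if -(3 / 4) * D * T < Z T ω then (1 : ℝ) else 0)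
        + ∑ t ∈ Finset.range n, if I t ω = i ∧ l ≤ pulls (fun s => I s ω) t i ∧
          ¬ (-(3 / 4) * D * pulls (fun s => I s ω) t i < Z (pulls (fun s => I s ω) t i) ω)
          then (1 : ℝ) else 0) ∂P := by
        refine integral_mono (integrable_pulls hI n i)
          (hfirst.add (integrable_finsetSum _ fun t _ => hgoodint t)) fun ω => ?_
        exact pulls_le_add_sum (fun s => I s ω) l n i hl1 (fun T => -(3 / 4) * D * T < Z T ω)
    _ ≤ l + 32 / D ^ 2 + 27 / D ^ 2 := by
        rw [integral_add hfirst (integrable_finsetSum _ fun t _ => hgoodint t),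
          integral_add (integrable_const _) (integrable_finsetSum _ fun T _ => hbadint T),
          integral_finsetSum _ fun T _ => hbadint T, integral_finsetSum _ fun t _ => hgoodint t]
        simp only [integral_const, probReal_univ, one_smul]
        exact add_le_add (add_le_add le_rfl hbad) hgood
    _ ≤ 8 * (1 + Real.log (D / ε)) / D ^ 2 + 1 + 32 / D ^ 2 + 27 / D ^ 2 := by gcongr
    -- Here 67 = 8 + 32 + 27, from the threshold, the bad counts and the good pulls.
    _ = 1 + (67 + 8 * Real.log (D / ε)) / D ^ 2 := by ring
    _ ≤ _ := by gcongr; norm_num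

/-! ### Regret decomposition over arms. -/

theorem regret_eq_sum (hI : IsPolicyRun P muStar ε X I) (n : ℕ) :
    regret P ν I n = ∑ i, gap ν i * ∫ ω, (pulls (fun s => I s ω) n i : ℝ) ∂P := by
  have h : ∀ ω, ∑ t ∈ Finset.range n, ((⨆ j, mean ν j) - mean ν (I t ω))
      = ∑ i, gap ν i * (pulls (fun s => I s ω) n i : ℝ) := fun ω => by
    rw [← Finset.sum_fiberwise (Finset.range n) (fun t => I t ω)]
    refine Finset.sum_congr rfl fun i _ => ?_
    rw [Finset.sum_congr rfl (g := fun _ => gap ν i) fun t ht => by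
      rw [(Finset.mem_filter.1 ht).2]; rfl]
    rw [Finset.sum_const, nsmul_eq_mul, mul_comm]
    rfl
  unfold regret
  simp_rw [h]
  rw [integral_finsetSum _ fun i _ => (integrable_pulls hI n i).const_mul _]
  simp_rw [integral_const_mul]

end Policy

end Bandit
end

theorem theorem3 {K : ℕ} (ν : Fin K → MeasureTheory.Measure ℝ) (muStar ε : ℝ)
    (hν : Bandit.IsBPR ν muStar ε)
    {Ω : Type*} [MeasurableSpace Ω] (P : MeasureTheory.Measure Ω)
    [MeasureTheory.IsProbabilityMeasure P]
    (X : Fin K → ℕ → Ω → ℝ) (hX : Bandit.IsRewardTable P ν X)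
    (I : ℕ → Ω → Fin K) (hI : Bandit.IsPolicyRun P muStar ε X I) (n : ℕ) :
    Bandit.regret P ν I n ≤
      ∑ i with 0 < Bandit.gap ν i,
        (Bandit.gap ν i + (80 + 8 * Real.log (Bandit.gap ν i / ε)) / Bandit.gap ν i) := by
  rw [Bandit.regret_eq_sum hI, Finset.sum_filter]
  refine Finset.sum_le_sum fun i _ => ?_
  have hgap : Bandit.gap ν i = muStar - Bandit.mean ν i := by
    rw [Bandit.gap, hν.iSup_mean]
  split_ifs with h
  · have hε : ε ≤ Bandit.gap ν i := by
      obtain ⟨b, hb, hother⟩ := hν.best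
      have hib : i ≠ b := fun hib => by
        rw [hgap, hib, hb, sub_self] at h
        exact lt_irrefl _ h
      linarith [hother i hib]
    calc _ ≤ Bandit.gap ν i *
          (1 + (80 + 8 * Real.log (Bandit.gap ν i / ε)) / Bandit.gap ν i ^ 2) :=
          mul_le_mul_of_nonneg_left (Bandit.integral_pulls_le hν hX hI hgap hε n) h.le
      _ = _ := by field_simp
  · exact mul_nonpos_of_nonpos_of_nonneg (not_lt.1 h)
      (MeasureTheory.integral_nonneg fun _ => Nat.cast_nonneg _)
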